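/- Let $X_\Gamma$ be a finite connected graph (a finite connected CW complex of dimension at most one; loops and multiple edges are allowed), with base point a vertex $x_0$, fundamental group $\Gamma=\pi_1(X_\Gamma,x_0)$ and universal covering $X$. Let $\mathcal F_\Gamma$ be a hermitian locally constant sheaf of finite dimensional complex vector spaces on $X_\Gamma$ (parallel transport is unitary). For a subgroup $\Gamma'\subset\Gamma$ let $X_{\Gamma'}=\Gamma'\backslash X$ be the corresponding covering graph, $\mathcal F_{\Gamma'}$ the pullback of $\mathcal F_\Gamma$ to $X_{\Gamma'}$, and $$Z_{\Gamma',\mathcal F}(u)=\prod_{\gamma}\det\bigl(1-u^{l(\gamma)}m_\gamma\bigr),$$ where $\gamma$ runs over the primitive closed geodesics of $X_{\Gamma'}$, i.e. the closed edge paths of positive length without backtracking (also at the base point) which are not a power of a shorter closed path; these are oriented and are taken up to the choice of the starting point. Here $l(\gamma)$ is the number of edges of $\gamma$ and $m_\gamma$ is the monodromy of $\mathcal F_{\Gamma'}$ along $\gamma$. A tower in $\Gamma$ is a decreasing sequence $\Gamma=\Gamma_1\supset\Gamma_2\supset\cdots$ of normal subgroups of finite index with $\bigcap_j\Gamma_j=\{1\}$.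 Then there is $r>0$, depending only on $X_\Gamma$ and $\mathcal F_\Gamma$, such that for every tower $(\Gamma_j)$ in $\Gamma$ the following hold. For every $j$ the product $Z_{\Gamma_j,\mathcal F}(u)$ converges absolutely for $|u|<r$, and it has a continuous $[\Gamma:\Gamma_j]$-th root on the disc $|u|<r$ with value $1$ at $u=0$. If $Z_{\Gamma_j,\mathcal F}(u)^{1/[\Gamma:\Gamma_j]}$ denotes this root, then for every $u\in\mathbb C$ with $|u|<r$ $$\lim_{j\to\infty}Z_{\Gamma_j,\mathcal F}(u)^{1/[\Gamma:\Gamma_j]}=1 .$$ -/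

import Mathlib

open CategoryTheory

/-!
A graph (one-dimensional CW complex) is encoded by a quiver: the objects are the vertices, and
every arrow `a ⟶ b` is one edge attached to `a` and `b`, with a chosen orientation.  Loops and
multiple edges are allowed.  The arrows of `Quiver.Symmetrify Q` are the edges with either
orientation, `Quiver.reverse` is the change of orientation, and edge paths in the graph are
`Quiver.Path`s in `Quiver.Symmetrify Q`.
-/

namespace GraphZeta

universe u v w

section Geodesics

variable {Q : Type u} [Quiver.{v} Q]

/-- `q` traversed `n` times. -/
def pathPow {a : Quiver.Symmetrify Q} (q : Quiver.Path a a) : ℕ → Quiver.Path a a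
  | 0 => Quiver.Path.nil
  | n + 1 => (pathPow q n).comp q

/-- The edge path `p` is a local geodesic: it never traverses an oriented edge and immediately
afterwards the same edge in the opposite direction. -/
def IsReduced {a b : Quiver.Symmetrify Q} (p : Quiver.Path a b) : Prop :=
  ∀ (c d : Quiver.Symmetrify Q) (e : c ⟶ d) (p₁ : Quiver.Path a c) (p₂ : Quiver.Path c b),
    p ≠ ((p₁.cons e).cons (Quiver.reverse e)).comp p₂

/-- A closed edge path of positive length is a closed geodesic if it is locally geodesic
everywhere, including at its base point, i.e. if traversing it twice gives a local geodesic. -/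
def IsClosedGeodesic {a : Quiver.Symmetrify Q} (p : Quiver.Path a a) : Prop :=
  0 < p.length ∧ IsReduced (p.comp p)

/-- A closed path is primitive if it is not a power of a shorter one. -/
def IsPrimitive {a : Quiver.Symmetrify Q} (p : Quiver.Path a a) : Prop :=
  ¬ ∃ (q : Quiver.Path a a) (n : ℕ), q.length < p.length ∧ p = pathPow q n

variable (Q)

/-- Primitive closed geodesics together with a vertex on them, as a starting point. -/
structure BasedPrimitiveGeodesic where
  base : Quiver.Symmetrify Q
  path : Quiver.Path base base
  isClosedGeodesic : IsClosedGeodesic path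
  isPrimitive : IsPrimitive path

variable {Q}

/-- Two based closed geodesics differ only by the choice of the starting point. -/
def BasedPrimitiveGeodesic.IsRotation (c d : BasedPrimitiveGeodesic Q) : Prop :=
  ∃ (p : Quiver.Path c.base d.base) (q : Quiver.Path d.base c.base),
    c.path = p.comp q ∧ d.path = q.comp p

variable (Q)

/-- The (oriented) primitive closed geodesics of the graph `Q`, up to the choice of the
starting point. -/
def PrimitiveGeodesic : Type _ :=
  Quot (BasedPrimitiveGeodesic.IsRotation (Q := Q))

/-- A hermitian locally constant sheaf of finite dimensional complex vector spaces on the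
graph `Q`: a finite dimensional hermitian stalk at each vertex, and a unitary parallel transport
along each edge. -/
structure HermitianLocalSystem where
  stalk : Q → Type w
  [normedAddCommGroup : ∀ a, NormedAddCommGroup (stalk a)]
  [innerProductSpace : ∀ a, InnerProductSpace ℂ (stalk a)]
  [finiteDimensional : ∀ a, FiniteDimensional ℂ (stalk a)]
  edgeTransport : ∀ {a b : Q}, (a ⟶ b) → (stalk a ≃ₗᵢ[ℂ] stalk b)

attribute [instance] HermitianLocalSystem.normedAddCommGroup
  HermitianLocalSystem.innerProductSpace HermitianLocalSystem.finiteDimensional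

variable {Q}

namespace HermitianLocalSystem

variable (F : HermitianLocalSystem.{u, v, w} Q)

/-- `Quiver.Symmetrify Q` has the same vertices as `Q`. -/
def toVertex (a : Quiver.Symmetrify Q) : Q := a

/-- The stalk at a vertex, with the vertex seen in the symmetrified quiver. -/
abbrev symmStalk (a : Quiver.Symmetrify Q) : Type w := F.stalk (toVertex a)

/-- Parallel transport along an oriented edge. -/
def orientedTransport {a b : Quiver.Symmetrify Q} (e : a ⟶ b) :
    F.symmStalk a ≃ₗᵢ[ℂ] F.symmStalk b :=
  match e with
  | Sum.inl e => F.edgeTransport (a := toVertex a) (b := toVertex b) e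
  | Sum.inr e => (F.edgeTransport (a := toVertex b) (b := toVertex a) e).symm

/-- Parallel transport along an edge path. -/
def transport {a : Quiver.Symmetrify Q} :
    ∀ {b : Quiver.Symmetrify Q}, Quiver.Path a b → (F.symmStalk a ≃ₗᵢ[ℂ] F.symmStalk b)
  | _, .nil => LinearIsometryEquiv.refl ℂ _
  | _, .cons p e => (transport p).trans (F.orientedTransport e)

/-- The monodromy operator of a closed edge path on the stalk over its base point. -/
def monodromy {a : Quiver.Symmetrify Q} (p : Quiver.Path a a) :
    F.symmStalk a →ₗ[ℂ] F.symmStalk a :=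
  (F.transport p).toLinearEquiv.toLinearMap

theorem transport_comp {a b c : Quiver.Symmetrify Q} (p : Quiver.Path a b)
    (q : Quiver.Path b c) :
    F.transport (p.comp q) = (F.transport p).trans (F.transport q) := by
  induction q with
  | nil => rfl
  | cons q e ih =>
    rw [Quiver.Path.comp_cons, transport, ih]
    rfl

/-- The factor `det (1 - u ^ l(γ) m_γ)` of a based closed path. -/
noncomputable def pathFactor {a : Quiver.Symmetrify Q} (p : Quiver.Path a a) (u : ℂ) : ℂ :=
  LinearMap.det (LinearMap.id - u ^ p.length • F.monodromy p)

theorem pathFactor_rotate {a b : Quiver.Symmetrify Q} (p : Quiver.Path a b)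
    (q : Quiver.Path b a) (u : ℂ) :
    F.pathFactor (p.comp q) u = F.pathFactor (q.comp p) u := by
  unfold pathFactor
  rw [← LinearMap.det_conj (LinearMap.id - u ^ (p.comp q).length • F.monodromy (p.comp q))
    (F.transport p).toLinearEquiv]
  congr 1
  ext x
  simp [monodromy, transport_comp, Quiver.Path.length_comp, add_comm]

/-- The factor `det (1 - u ^ l(γ) m_γ)` of a primitive closed geodesic; it does not depend on the
starting point. -/
noncomputable def eulerFactor (γ : PrimitiveGeodesic Q) (u : ℂ) : ℂ :=
  Quot.lift (fun c : BasedPrimitiveGeodesic Q => F.pathFactor c.path u)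
    (by
      rintro ⟨a, c, _, _⟩ ⟨b, d, _, _⟩ ⟨p, q, hc, hd⟩
      dsimp only at p q hc hd ⊢
      rw [hc, hd, F.pathFactor_rotate]) γ

/-- The zeta function `Z(u) = ∏_γ det (1 - u ^ l(γ) m_γ)`, the product over all primitive closed
geodesics. -/
noncomputable def zeta (u : ℂ) : ℂ := ∏' γ : PrimitiveGeodesic Q, F.eulerFactor γ u

/-- Absolute convergence of the product that defines `Z(u)`. -/
def ZetaConverges (u : ℂ) : Prop :=
  Summable fun γ : PrimitiveGeodesic Q => ‖F.eulerFactor γ u - 1‖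

/-- The pullback along a morphism of graphs. -/
def pullback {P : Type*} [Quiver P] (φ : P ⥤q Q) : HermitianLocalSystem P where
  stalk a := F.stalk (φ.obj a)
  edgeTransport e := F.edgeTransport (φ.map e)

end HermitianLocalSystem

end Geodesics

section Coverings

variable {Q : Type u} [Quiver.{v} Q]

/-- Homotopy classes of edge paths from `a` to `b` in the graph `Q`. -/
abbrev HomotopyClass (a b : Q) : Type _ :=
  (Quiver.FreeGroupoid.of Q).obj a ⟶ (Quiver.FreeGroupoid.of Q).obj b

/-- The fundamental group of the graph `Q` at `a`, with concatenation as multiplication. -/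
abbrev FundGroup (a : Q) : Type _ := HomotopyClass a a

/-- The orbit relation of the action of `H ≤ Γ` by concatenation on the homotopy classes of
paths from `x₀` to `a`, i.e. on the vertices over `a` of the universal covering of `Q`. -/
def coverSetoid {x₀ : Q} (H : Subgroup (FundGroup x₀)) (a : Q) : Setoid (HomotopyClass x₀ a) where
  r p q := ∃ h : FundGroup x₀, h ∈ H ∧ h ≫ p = q
  iseqv :=
    { refl := fun p => ⟨1, H.one_mem, Category.id_comp p⟩
      symm := by
        rintro p q ⟨h, hh, rfl⟩
        refine ⟨h⁻¹, H.inv_mem hh, ?_⟩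
        rw [← Category.assoc]
        exact (congrArg (· ≫ p) (inv_mul_cancel h)).trans (Category.id_comp p)
      trans := by
        rintro p q s ⟨h, hh, rfl⟩ ⟨k, hk, rfl⟩
        exact ⟨k * h, H.mul_mem hk hh, Category.assoc k h p⟩ }

/-- The covering graph `H \ X` of `Q`, where `X` is the universal covering of `Q` and `H` is a
subgroup of the fundamental group.  A vertex of `X` is a vertex `pt` of `Q` with a homotopy class
of paths from `x₀` to `pt`; a vertex of `H \ X` is an `H`-orbit of these. -/
structure Cover {x₀ : Q} (H : Subgroup (FundGroup x₀)) where
  pt : Q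
  cls : Quotient (coverSetoid H pt)

variable {x₀ : Q} (H : Subgroup (FundGroup x₀))

/-- The end point of the lift of the edge `e` to `H \ X` with a given starting point. -/
def liftEnd {a b : Q} (e : a ⟶ b) :
    Quotient (coverSetoid H a) → Quotient (coverSetoid H b) :=
  Quotient.map (fun p => p ≫ (Quiver.FreeGroupoid.of Q).map e) (by
    rintro p q ⟨h, hh, rfl⟩
    exact ⟨h, hh, (Category.assoc _ _ _).symm⟩)

/-- The edges of `H \ X` from `A` to `B` are the edges of `Q` whose lift starting at `A`
ends at `B`. -/
instance : Quiver (Cover H) where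
  Hom A B := { e : A.pt ⟶ B.pt // liftEnd H e A.cls = B.cls }

/-- The covering map `H \ X → Q`. -/
def coverMap : Cover H ⥤q Q where
  obj A := A.pt
  map e := e.1

end Coverings

/-- A tower in a group: a decreasing sequence of normal subgroups of finite index which starts
with the whole group and has trivial intersection. -/
structure IsTower {G : Type*} [Group G] (Γ : ℕ → Subgroup G) : Prop where
  zero : Γ 0 = ⊤
  antitone : Antitone Γ
  iInf_eq_bot : ⨅ j, Γ j = ⊥
  normal : ∀ j, (Γ j).Normal
  finiteIndex : ∀ j, (Γ j).FiniteIndex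

/-- `f` is the `N`-th root `Z ^ (1 / N)` on the disc `|u| < r`: the continuous branch with
value `1` at `u = 0`. -/
structure IsRootOnDisc (N : ℕ) (r : ℝ) (Z f : ℂ → ℂ) : Prop where
  continuousOn : ContinuousOn f (Metric.ball 0 r)
  map_zero : f 0 = 1
  pow_eq : ∀ u ∈ Metric.ball (0 : ℂ) r, f u ^ N = Z u

end GraphZeta

/-!
On a small disc the logarithm of `Z_j` is the sum of the logarithms of the Euler factors, and
because parallel transport is unitary the factor of `γ` differs from `1` by at most `C * r ^ l(γ)`
with a constant `C` that depends only on the dimensions of the stalks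
(`norm_pathFactor_sub_one_le`).  The exponential of the sum divided by `[Γ : Γ_j]` is a continuous
root (`exists_log_zeta`), and such a root is unique as the disc is connected
(`IsRootOnDisc.eqOn`).  It remains to see that `[Γ : Γ_j]⁻¹ ∑ r ^ l(γ)`, the sum over the primitive
closed geodesics of the `j`-th covering, tends to zero.

A closed geodesic of the covering with a starting point is determined by its projection, a closed
path of the base graph, together with a point of a fibre, and every fibre has `[Γ : Γ_j]` points.
So the normalized sum is at most the sum of `r ^ l(p)` over those closed paths `p` of the base graph
which have a closed lift and arise as projections of geodesics
(`summable_pow_length_and_tsum_le`).  Projections of geodesics are reduced, and reduced paths of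
positive length are not homotopic to a point (`pathClass_ne_id`); this is seen by mapping the free
groupoid to the free group on the edges, where such a path becomes a nonempty reduced word.  By
normality a closed path `p` has a closed lift exactly if its class, transported to the base point,
lies in `Γ_j`; since the `Γ_j` decrease to the trivial group, this fails for large `j` unless `p` is
homotopic to a point (`eventually_liftWeight_eq_zero`).  All the sums are dominated by the sum of
`r ^ l(p)` over all closed paths of the finite base graph, which converges for small `r`, so they
tend to zero by dominated convergence (`tendsto_tsum_liftWeight`).
-/

namespace GraphZeta

/-! ### Determinants close to the identity -/

theorem norm_prod_one_add_sub_one_le_of_le {ι : Type*} (s : Finset ι) (a : ι → ℂ) {ε : ℝ}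
    (hε : ε ≤ 1) (ha : ∀ i ∈ s, ‖a i‖ ≤ ε) :
    ‖∏ i ∈ s, (1 + a i) - 1‖ ≤ (2 ^ s.card - 1) * ε := by
  classical
  induction s using Finset.induction_on with
  | empty => simp
  | insert i s hi ih =>
    have ih := ih fun k hk => ha k (Finset.mem_insert_of_mem hk)
    have hi' := ha i (Finset.mem_insert_self i s)
    have hε0 : 0 ≤ ε := (norm_nonneg _).trans hi'
    have h2 : ‖∏ i ∈ s, (1 + a i)‖ ≤ 2 ^ s.card := by
      have h1 : (1 : ℝ) ≤ 2 ^ s.card := one_le_pow₀ (by norm_num)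
      calc ‖∏ i ∈ s, (1 + a i)‖ = ‖(∏ i ∈ s, (1 + a i) - 1) + 1‖ := by ring_nf
        _ ≤ (2 ^ s.card - 1) * ε + 1 := (norm_add_le _ _).trans (by simpa using ih)
        _ ≤ 2 ^ s.card := by nlinarith
    rw [Finset.prod_insert hi, Finset.card_insert_of_notMem hi]
    calc ‖(1 + a i) * ∏ i ∈ s, (1 + a i) - 1‖
        = ‖(∏ i ∈ s, (1 + a i) - 1) + a i * ∏ i ∈ s, (1 + a i)‖ := by ring_nf
      _ ≤ (2 ^ s.card - 1) * ε + ε * 2 ^ s.card := by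
        refine (norm_add_le _ _).trans (add_le_add ih ?_)
        rw [norm_mul]
        gcongr
      _ = _ := by ring

/-- In the Leibniz expansion the identity permutation contributes `1` up to a multiple of `ε`, and
every other permutation has an off-diagonal factor of size at most `ε`. -/
theorem norm_det_one_add_sub_one_le {n : Type*} [Fintype n] [DecidableEq n]
    (A : Matrix n n ℂ) {ε : ℝ} (hε0 : 0 ≤ ε) (hε : ε ≤ 1) (hA : ∀ i j, ‖A i j‖ ≤ ε) :
    ‖(1 + A).det - 1‖ ≤ (Fintype.card n).factorial * 2 ^ Fintype.card n * ε := by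
  have key : ∀ σ : Equiv.Perm n,
      ‖Equiv.Perm.sign σ • ∏ i, (1 + A) (σ i) i - if σ = 1 then 1 else 0‖ ≤
        2 ^ Fintype.card n * ε := by
    intro σ
    split_ifs with h
    · subst h
      have := norm_prod_one_add_sub_one_le_of_le Finset.univ (fun i => A i i) hε
        fun i _ => hA i i
      simp only [Equiv.Perm.sign_one, one_smul, Equiv.Perm.coe_one, id, Matrix.add_apply,
        Matrix.one_apply_eq]
      refine this.trans ?_
      rw [Finset.card_univ]
      gcongr
      linarith
    · obtain ⟨i, hi⟩ : ∃ i, σ i ≠ i := by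
        by_contra! h'
        exact h (Equiv.ext h')
      have hb : ∀ i j, ‖(1 + A) i j‖ ≤ 2 := fun i j => by
        have h1 : ‖(1 : Matrix n n ℂ) i j‖ ≤ 1 := by
          rw [Matrix.one_apply]
          split_ifs <;> simp
        exact (norm_add_le _ _).trans (by linarith [hA i j])
      have hs : ‖Equiv.Perm.sign σ • ∏ i, (1 + A) (σ i) i‖ = ∏ i, ‖(1 + A) (σ i) i‖ := by
        rw [← norm_prod]
        rcases Int.units_eq_one_or (Equiv.Perm.sign σ) with h | h <;> simp [h]
      rw [sub_zero, hs, ← Finset.mul_prod_erase _ _ (Finset.mem_univ i), mul_comm]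
      refine mul_le_mul ?_ ?_ (norm_nonneg _) (by positivity)
      · calc _ ≤ ∏ _i ∈ Finset.univ.erase i, (2 : ℝ) :=
              Finset.prod_le_prod (fun _ _ => norm_nonneg _) fun _ _ => hb _ _
          _ ≤ 2 ^ Fintype.card n := by
              rw [Finset.prod_const]
              exact pow_le_pow_right₀ (by norm_num) (Finset.card_le_univ _)
      · rw [Matrix.add_apply, Matrix.one_apply_ne hi, zero_add]
        exact hA _ _
  calc ‖(1 + A).det - 1‖
      = ‖∑ σ : Equiv.Perm n,
          (Equiv.Perm.sign σ • ∏ i, (1 + A) (σ i) i - if σ = 1 then 1 else 0)‖ := by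
        rw [Finset.sum_sub_distrib, ← Matrix.det_apply]
        simp
    _ ≤ ∑ _σ : Equiv.Perm n, 2 ^ Fintype.card n * ε := norm_sum_le_of_le _ fun σ _ => key σ
    _ = _ := by
        rw [Finset.sum_const, Finset.card_univ, Fintype.card_perm, nsmul_eq_mul, mul_assoc]

/-! ### Euler factors of closed paths -/

section PathFactor

variable {Q : Type*} [Quiver Q] (F : HermitianLocalSystem Q)

theorem pathFactor_eq_det {a : Quiver.Symmetrify Q} (p : Quiver.Path a a) (u : ℂ) :
    F.pathFactor p u = (1 + -u ^ p.length • LinearMap.toMatrix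
      (stdOrthonormalBasis ℂ (F.symmStalk a)).toBasis
      (stdOrthonormalBasis ℂ (F.symmStalk a)).toBasis (F.monodromy p)).det := by
  rw [HermitianLocalSystem.pathFactor, ← LinearMap.det_toMatrix
    (stdOrthonormalBasis ℂ (F.symmStalk a)).toBasis, map_sub, map_smul, LinearMap.toMatrix_id,
    sub_eq_add_neg, neg_smul]

theorem continuous_pathFactor {a : Quiver.Symmetrify Q} (p : Quiver.Path a a) :
    Continuous (F.pathFactor p) := by
  simp only [funext (pathFactor_eq_det F p)]
  fun_prop

theorem pathFactor_zero {a : Quiver.Symmetrify Q} {p : Quiver.Path a a} (hp : 0 < p.length) :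
    F.pathFactor p 0 = 1 := by
  simp [pathFactor_eq_det, hp.ne']

/-- The monodromy being unitary, its matrix in an orthonormal basis has entries of norm at most
one, whatever the path; only the dimension of the stalk enters the constant. -/
theorem norm_pathFactor_sub_one_le {a : Quiver.Symmetrify Q} (p : Quiver.Path a a) {u : ℂ}
    (hu : ‖u‖ ≤ 1) :
    ‖F.pathFactor p u - 1‖ ≤ (Module.finrank ℂ (F.symmStalk a)).factorial *
      2 ^ Module.finrank ℂ (F.symmStalk a) * ‖u‖ ^ p.length := by
  rw [pathFactor_eq_det]
  refine (norm_det_one_add_sub_one_le _ (pow_nonneg (norm_nonneg u) p.length)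
    (pow_le_one₀ (norm_nonneg _) hu) fun i j => ?_).trans (by simp)
  have h : ‖LinearMap.toMatrix (stdOrthonormalBasis ℂ (F.symmStalk a)).toBasis
      (stdOrthonormalBasis ℂ (F.symmStalk a)).toBasis (F.monodromy p) i j‖ ≤ 1 := by
    rw [LinearMap.toMatrix_apply, OrthonormalBasis.coe_toBasis_repr_apply,
      OrthonormalBasis.repr_apply_apply]
    refine (norm_inner_le_norm _ _).trans ?_
    simp [HermitianLocalSystem.monodromy]
  rw [Matrix.smul_apply, smul_eq_mul, norm_mul, norm_neg, norm_pow]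
  exact mul_le_of_le_one_right (by positivity) h

end PathFactor

/-! ### Edge paths as words in the free group on the edges -/

section Words

variable {Q : Type*} [Quiver Q]

/-- An oriented edge as a letter of the free group on the edges: the edge, with `true` if it is
traversed in its chosen orientation and `false` otherwise. -/
def letter {a b : Quiver.Symmetrify Q} (e : a ⟶ b) : (Σ a b : Q, a ⟶ b) × Bool :=
  match e with
  | Sum.inl e => (⟨_, _, e⟩, true)
  | Sum.inr e => (⟨_, _, e⟩, false)

/-- The letters of an edge path, the last edge first.  The order is reversed because composition
in the one-object category of a group is `f ≫ g = g * f`. -/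
def word {a : Quiver.Symmetrify Q} :
    ∀ {b : Quiver.Symmetrify Q}, Quiver.Path a b → List ((Σ a b : Q, a ⟶ b) × Bool)
  | _, .nil => []
  | _, .cons p e => letter e :: word p

theorem length_word {a b : Quiver.Symmetrify Q} (p : Quiver.Path a b) :
    (word p).length = p.length := by
  induction p with
  | nil => rfl
  | cons p e ih => simp [word, ih]

theorem length_mapPath {P : Type*} [Quiver P] (φ : P ⥤q Q) {a b : P} (p : Quiver.Path a b) :
    (φ.mapPath p).length = p.length := by
  induction p with
  | nil => rfl
  | cons p e ih => simp [ih]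

theorem letter_reverse {a b : Quiver.Symmetrify Q} (e : a ⟶ b) :
    letter (Quiver.reverse e) = ((letter e).1, !(letter e).2) := by
  rcases e with e | e <;> rfl

theorem letter_injective (a : Quiver.Symmetrify Q) :
    Function.Injective fun e : Quiver.Star a => letter e.2 := by
  rintro ⟨b, e | e⟩ ⟨c, f | f⟩ h
  · simp only [letter, Prod.mk.injEq, and_true] at h
    cases h
    rfl
  · simp [letter] at h
  · simp [letter] at h
  · simp only [letter, Prod.mk.injEq, and_true] at h
    cases h
    rfl

theorem word_injective (a : Quiver.Symmetrify Q) :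
    Function.Injective fun p : Quiver.PathStar a => word p.2 := by
  rintro ⟨b, p⟩ ⟨c, q⟩ h
  induction p generalizing c with
  | nil =>
    cases q with
    | nil => rfl
    | cons q f => simp [word] at h
  | cons p e ih =>
    cases q with
    | nil => simp [word] at h
    | cons q f =>
      simp only [word, List.cons.injEq] at h
      cases ih _ q h.2
      cases letter_injective _ (a₁ := ⟨_, e⟩) (a₂ := ⟨_, f⟩) h.1
      rfl

theorem IsReduced.of_comp_left {a b c : Quiver.Symmetrify Q} {p : Quiver.Path a b}
    {q : Quiver.Path b c} (h : IsReduced (p.comp q)) : IsReduced p := by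
  intro x y e p₁ p₂ hp
  refine h x y e p₁ (p₂.comp q) ?_
  rw [hp, Quiver.Path.comp_assoc]

/-- A covering is injective on the edges issuing from a vertex, so it does not create
backtracking. -/
theorem IsReduced.isReduced_word_mapPath {P : Type*} [Quiver P] {φ : P ⥤q Q} (hφ : φ.IsCovering)
    {a b : Quiver.Symmetrify P} {p : Quiver.Path a b} (hp : IsReduced p) :
    FreeGroup.IsReduced (word (φ.symmetrify.mapPath p)) := by
  induction p with
  | nil => exact FreeGroup.IsReduced.nil
  | cons p e ih =>
    have ih := ih (hp.of_comp_left (q := e.toPath))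
    cases p with
    | nil => exact FreeGroup.IsReduced.singleton
    | cons p f =>
      refine FreeGroup.isReduced_cons_cons.2 ⟨fun h₁ => ?_, ih⟩
      by_contra h₂
      have h : letter (φ.symmetrify.map e) = letter (φ.symmetrify.map (Quiver.reverse f)) := by
        rw [Prefunctor.map_reverse, letter_reverse]
        exact Prod.ext h₁ (Bool.eq_not_of_ne h₂)
      cases (hφ.symmetrify.star_bijective _).1 (a₁ := ⟨_, e⟩) (a₂ := ⟨_, Quiver.reverse f⟩)
        (letter_injective _ (a₁ := ⟨_, φ.symmetrify.map e⟩)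
          (a₂ := ⟨_, φ.symmetrify.map (Quiver.reverse f)⟩) h)
      exact hp _ _ f p Quiver.Path.nil rfl

end Words

/-! ### Homotopy classes of reduced paths -/

section HomotopyClasses

variable {Q : Type*} [Quiver Q]

/-- The homotopy class of an oriented edge. -/
def edgeClass {a b : Quiver.Symmetrify Q} (e : a ⟶ b) : HomotopyClass (Q := Q) a b :=
  match e with
  | Sum.inl e => (Quiver.FreeGroupoid.of Q).map e
  | Sum.inr e => Groupoid.inv ((Quiver.FreeGroupoid.of Q).map e)

/-- The homotopy class of an edge path. -/
def pathClass {a : Quiver.Symmetrify Q} :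
    ∀ {b : Quiver.Symmetrify Q}, Quiver.Path a b → HomotopyClass (Q := Q) a b
  | _, .nil => 𝟙 _
  | _, .cons p e => pathClass p ≫ edgeClass e

variable (Q) in
/-- The functor from the free groupoid to the free group on the edges that sends every edge to
the corresponding generator. -/
def toFreeGroup : Quiver.FreeGroupoid Q ⥤ SingleObj (FreeGroup (Σ a b : Q, a ⟶ b)) :=
  Quiver.FreeGroupoid.lift
    { obj := fun _ => SingleObj.star _
      map := fun {a b} e => (FreeGroup.of ⟨a, b, e⟩ : FreeGroup (Σ a b : Q, a ⟶ b)) }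

theorem toFreeGroup_map_of {a b : Q} (e : a ⟶ b) :
    (toFreeGroup Q).map ((Quiver.FreeGroupoid.of Q).map e) =
      (FreeGroup.of ⟨a, b, e⟩ : FreeGroup (Σ a b : Q, a ⟶ b)) :=
  mul_one (FreeGroup.of (⟨a, b, e⟩ : Σ a b : Q, a ⟶ b))

theorem toFreeGroup_map_inv_of {a b : Q} (e : a ⟶ b) :
    (toFreeGroup Q).map (Groupoid.inv ((Quiver.FreeGroupoid.of Q).map e)) =
      (FreeGroup.of ⟨a, b, e⟩ : FreeGroup (Σ a b : Q, a ⟶ b))⁻¹ := by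
  rw [Groupoid.inv_eq_inv, Functor.map_inv, ← Groupoid.inv_eq_inv, toFreeGroup_map_of]
  rfl

theorem toFreeGroup_map_edgeClass {a b : Quiver.Symmetrify Q} (e : a ⟶ b) :
    (toFreeGroup Q).map (edgeClass e) = FreeGroup.mk [letter e] := by
  rcases e with e | e
  · exact toFreeGroup_map_of e
  · exact toFreeGroup_map_inv_of e

theorem toFreeGroup_map_pathClass {a b : Quiver.Symmetrify Q} (p : Quiver.Path a b) :
    (toFreeGroup Q).map (pathClass p) = FreeGroup.mk (word p) := by
  induction p with
  | nil => exact (toFreeGroup Q).map_id _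
  | cons p e ih =>
    refine ((toFreeGroup Q).map_comp _ _).trans ?_
    rw [ih, toFreeGroup_map_edgeClass]
    exact FreeGroup.mul_mk

/-- A reduced path of positive length is not homotopic to a point, since its image in the free
group is a nonempty reduced word. -/
theorem pathClass_ne_id {a : Quiver.Symmetrify Q} {p : Quiver.Path a a} (h₀ : 0 < p.length)
    (hp : FreeGroup.IsReduced (word p)) : pathClass p ≠ 𝟙 _ := by
  classical
  intro h
  have h₁ : FreeGroup.mk (word p) = 1 := by
    rw [← toFreeGroup_map_pathClass, h]
    exact (toFreeGroup Q).map_id _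
  have h₂ : (FreeGroup.mk (word p)).toWord = word p := by
    rw [FreeGroup.toWord_mk, hp.reduce_eq]
  rw [h₁, FreeGroup.toWord_one] at h₂
  rw [← length_word, ← h₂] at h₀
  exact lt_irrefl 0 h₀

end HomotopyClasses

/-! ### Lifting paths to coverings -/

section Covers

variable {Q : Type*} [Quiver Q] {x₀ : Q} (H : Subgroup (FundGroup x₀))

theorem liftEnd_bijective {a b : Q} (e : a ⟶ b) : Function.Bijective (liftEnd H e) := by
  constructor
  · rintro ⟨p⟩ ⟨q⟩ h
    obtain ⟨k, hk, h⟩ := Quotient.exact h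
    refine Quotient.sound ⟨k, hk, ?_⟩
    rw [← Category.assoc] at h
    exact (cancel_mono _).1 h
  · rintro ⟨p⟩
    refine ⟨Quotient.mk _ (p ≫ Groupoid.inv ((Quiver.FreeGroupoid.of Q).map e)), ?_⟩
    exact congrArg (Quotient.mk _) (by simp)

theorem coverMap_isCovering : (coverMap H).IsCovering where
  star_bijective A := by
    constructor
    · rintro ⟨⟨b, y⟩, e, he⟩ ⟨⟨c, z⟩, f, hf⟩ h
      cases h
      cases he.symm.trans hf
      rfl
    · rintro ⟨b, e⟩
      exact ⟨⟨⟨b, liftEnd H e A.cls⟩, ⟨e, rfl⟩⟩, rfl⟩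
  costar_bijective A := by
    constructor
    · rintro ⟨⟨b, y⟩, e, he⟩ ⟨⟨c, z⟩, f, hf⟩ h
      cases h
      cases (liftEnd_bijective H _).1 (he.trans hf.symm)
      rfl
    · rintro ⟨b, e⟩
      obtain ⟨y, hy⟩ := (liftEnd_bijective H e).2 A.cls
      exact ⟨⟨⟨b, y⟩, ⟨e, hy⟩⟩, rfl⟩

/-- The end point of the lift of an edge path that starts at the orbit of `g` is the orbit of
`g` followed by the path. -/
theorem mk_comp_pathClass_mapPath {A B : Quiver.Symmetrify (Cover H)} (p : Quiver.Path A B)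
    (g : HomotopyClass x₀ (Cover.pt A)) (hg : Quotient.mk (coverSetoid H _) g = Cover.cls A) :
    Quotient.mk (coverSetoid H _) (g ≫ pathClass ((coverMap H).symmetrify.mapPath p)) =
      Cover.cls B := by
  induction p with
  | nil => exact (congrArg (Quotient.mk _) (Category.comp_id g)).trans hg
  | @cons B C p e ih =>
    have h : ∀ k : HomotopyClass x₀ (Cover.pt B), Quotient.mk (coverSetoid H _) k = Cover.cls B →
        Quotient.mk (coverSetoid H _) (k ≫ edgeClass ((coverMap H).symmetrify.map e)) =
          Cover.cls C := by
      intro k hk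
      rcases e with ⟨e, he⟩ | ⟨e, he⟩
      · rw [← hk] at he
        exact he
      · apply (liftEnd_bijective H e).1
        refine Eq.trans ?_ (hk.trans he.symm)
        exact congrArg (Quotient.mk _)
          ((Category.assoc _ _ _).trans ((congrArg (k ≫ ·) (Groupoid.inv_comp _)).trans
            (Category.comp_id k)))
    exact (congrArg (Quotient.mk _) (Category.assoc _ _ _).symm).trans (h _ ih)

/-- A closed path in `H \ X` starting at the orbit of `g` projects to a closed path whose conjugate
by `g` lies in `H`. -/
theorem exists_conj_pathClass_mem {A : Quiver.Symmetrify (Cover H)} (p : Quiver.Path A A) :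
    ∃ g : HomotopyClass x₀ (Cover.pt A),
      g ≫ pathClass ((coverMap H).symmetrify.mapPath p) ≫ Groupoid.inv g ∈ H := by
  obtain ⟨g, hg⟩ := Quotient.exists_rep (Cover.cls A)
  obtain ⟨h, hh, hgh⟩ := Quotient.exact (hg.trans (mk_comp_pathClass_mapPath H p g hg).symm)
  have h' : (h ≫ g) ≫ Groupoid.inv g = h := by simp
  refine ⟨g, ?_⟩
  rw [hgh] at h'
  exact (Category.assoc _ _ _).symm.trans h' ▸ hh

/-- The fibre of the covering is a torsor: a path from `x₀` to `a` identifies it with the right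
cosets of `H`. -/
theorem card_fibre_cover {a : Q} (g : HomotopyClass x₀ a) :
    Nat.card (Quotient (coverSetoid H a)) = H.index := by
  rw [Subgroup.index, Nat.card_congr (QuotientGroup.quotientRightRelEquivQuotientLeftRel H).symm]
  let e : HomotopyClass x₀ a ≃ FundGroup x₀ :=
    { toFun := fun p => p ≫ Groupoid.inv g
      invFun := fun p => p ≫ g
      left_inv := fun p => by simp
      right_inv := fun p => by simp }
  refine Nat.card_congr (Quotient.congr (ra := coverSetoid H a)
    (rb := QuotientGroup.rightRel H) e fun p q => ?_)
  rw [QuotientGroup.rightRel_apply]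
  constructor
  · rintro ⟨h, hh, rfl⟩
    have : e (h ≫ p) = h * e p :=
      show (h ≫ p) ≫ Groupoid.inv g = h ≫ p ≫ Groupoid.inv g from Category.assoc _ _ _
    rw [this, mul_inv_cancel_right]
    exact hh
  · intro h
    refine ⟨_, h, e.injective ?_⟩
    have : e ((e q * (e p)⁻¹) ≫ p) = e q * (e p)⁻¹ * e p :=
      show ((e q * (e p)⁻¹) ≫ p) ≫ Groupoid.inv g = (e q * (e p)⁻¹) ≫ p ≫ Groupoid.inv g from
        Category.assoc _ _ _
    rw [this, inv_mul_cancel_right]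

end Covers

/-! ### Closed paths with closed lifts in a tower -/

section ClosedPaths

theorem summable_pow_length_list {α : Type*} [Finite α] {r : ℝ} (hr : 0 ≤ r)
    (h : Nat.card α * r < 1) : Summable fun l : List α => r ^ l.length := by
  have := Fintype.ofFinite α
  rw [← List.equivSigmaTuple.symm.summable_iff]
  refine (summable_sigma_of_nonneg fun _ => pow_nonneg hr _).2
    ⟨fun n => (hasSum_fintype _).summable, ?_⟩
  refine (summable_geometric_of_lt_one (mul_nonneg (Nat.cast_nonneg _) hr) h).congr fun n => ?_
  simp [List.equivSigmaTuple, tsum_fintype, mul_pow]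

variable (Q : Type*) [Quiver Q]

/-- Closed edge paths in the graph `Q`, with their base point. -/
abbrev ClosedPath : Type _ := Σ a : Quiver.Symmetrify Q, Quiver.Path a a

variable {Q}

/-- The graph having `D` oriented edges, there are at most `D ^ n` closed paths of length `n` with
a given base point, hence convergence for `D * r < 1`. -/
theorem summable_pow_length_closedPath [Finite Q] [∀ a b : Q, Finite (a ⟶ b)] {r : ℝ}
    (hr : 0 ≤ r) (h : Nat.card ((Σ a b : Q, a ⟶ b) × Bool) * r < 1) :
    Summable fun s : ClosedPath Q => r ^ s.2.length := by
  have h₁ : Summable fun t : Q × List ((Σ a b : Q, a ⟶ b) × Bool) => (1 : ℝ) * r ^ t.2.length :=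
    have := Fintype.ofFinite Q
    Summable.mul_of_nonneg (hasSum_fintype _).summable (summable_pow_length_list hr h)
      (fun _ => zero_le_one) fun _ => pow_nonneg hr _
  have h₂ : Function.Injective fun s : ClosedPath Q =>
      ((s.1, word s.2) : Q × List ((Σ a b : Q, a ⟶ b) × Bool)) := by
    rintro ⟨a, p⟩ ⟨b, q⟩ hpq
    obtain ⟨rfl, hpq⟩ := Prod.ext_iff.1 hpq
    cases word_injective _ (a₁ := ⟨_, p⟩) (a₂ := ⟨_, q⟩) hpq
    rfl
  refine (h₁.comp_injective h₂).congr fun s => ?_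
  simp [length_word]

variable {x₀ : Q} (H : Subgroup (FundGroup x₀)) (r : ℝ)

open Classical in
/-- The weight `r ^ l` of a closed path of length `l` which is not homotopic to a point and has a
closed lift to `H \ X`; all other closed paths have weight zero. -/
noncomputable def liftWeight (s : ClosedPath Q) : ℝ :=
  if pathClass s.2 ≠ 𝟙 _ ∧ ∃ g : HomotopyClass (Q := Q) x₀ s.1,
    g ≫ pathClass s.2 ≫ Groupoid.inv g ∈ H then r ^ s.2.length else 0

variable {r}

theorem liftWeight_nonneg (hr : 0 ≤ r) (s : ClosedPath Q) : 0 ≤ liftWeight H r s := by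
  unfold liftWeight
  split_ifs
  exacts [pow_nonneg hr _, le_rfl]

theorem liftWeight_le (hr : 0 ≤ r) (s : ClosedPath Q) : liftWeight H r s ≤ r ^ s.2.length := by
  unfold liftWeight
  split_ifs
  exacts [le_rfl, pow_nonneg hr _]

theorem summable_liftWeight (hr : 0 ≤ r) (hs : Summable fun s : ClosedPath Q => r ^ s.2.length) :
    Summable (liftWeight H r) :=
  hs.of_nonneg_of_le (liftWeight_nonneg H hr) (liftWeight_le H hr)

/-- A closed path that is not homotopic to a point has no closed lift to the `j`-th covering of a
tower, for large `j`.  By normality, whether a lift is closed does not depend on its starting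
point. -/
theorem eventually_liftWeight_eq_zero
    (hconn : ∀ a b : Quiver.Symmetrify Q, Nonempty (Quiver.Path a b))
    {Γ : ℕ → Subgroup (FundGroup x₀)} (hΓ : IsTower Γ) (s : ClosedPath Q) :
    ∀ᶠ j in Filter.atTop, liftWeight (Γ j) r s = 0 := by
  obtain ⟨a, p⟩ := s
  by_cases hp : pathClass p = 𝟙 _
  · exact Filter.Eventually.of_forall fun j => if_neg fun h => h.1 hp
  obtain ⟨q⟩ := hconn x₀ a
  let k : HomotopyClass (Q := Q) x₀ a := pathClass q
  have hk : (k ≫ pathClass p ≫ Groupoid.inv k : FundGroup x₀) ≠ 1 := by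
    intro h
    apply hp
    have h' : Groupoid.inv k ≫ (k ≫ pathClass p ≫ Groupoid.inv k) ≫ k = pathClass p := by simp
    rw [← h']
    refine (congrArg (fun t => Groupoid.inv k ≫ t ≫ k) h).trans ?_
    exact (congrArg (Groupoid.inv k ≫ ·) (Category.id_comp k)).trans (Groupoid.inv_comp k)
  obtain ⟨j₀, hj₀⟩ : ∃ j, (k ≫ pathClass p ≫ Groupoid.inv k : FundGroup x₀) ∉ Γ j := by
    by_contra! h
    have := Subgroup.mem_iInf.2 h
    rw [hΓ.iInf_eq_bot] at this
    exact hk (Subgroup.mem_bot.1 this)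
  filter_upwards [Filter.eventually_ge_atTop j₀] with j hj
  refine if_neg fun ⟨_, g, hg⟩ => hj₀ (hΓ.antitone hj ?_)
  have h := (hΓ.normal j).conj_mem _ hg (k ≫ Groupoid.inv g)
  have h₁ : ((k ≫ Groupoid.inv g : FundGroup x₀))⁻¹ = g ≫ Groupoid.inv k := by
    refine inv_eq_of_mul_eq_one_right ?_
    show (k ≫ Groupoid.inv g) ≫ g ≫ Groupoid.inv k = 𝟙 _
    simp
  rw [h₁] at h
  have h₂ : ((k ≫ Groupoid.inv g) ≫ g ≫ pathClass p ≫ Groupoid.inv g) ≫ g ≫ Groupoid.inv k =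
    k ≫ pathClass p ≫ Groupoid.inv k := by simp
  rw [← h₂]
  exact h

/-- Dominated convergence: every weight is eventually zero, and the weights are bounded by the
summable family `r ^ l`, independently of the subgroup. -/
theorem tendsto_tsum_liftWeight
    (hconn : ∀ a b : Quiver.Symmetrify Q, Nonempty (Quiver.Path a b))
    {Γ : ℕ → Subgroup (FundGroup x₀)} (hΓ : IsTower Γ) (hr : 0 ≤ r)
    (hs : Summable fun s : ClosedPath Q => r ^ s.2.length) :
    Filter.Tendsto (fun j => ∑' s, liftWeight (Γ j) r s) Filter.atTop (nhds 0) := by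
  rw [← tsum_zero (α := ℝ) (β := ClosedPath Q)]
  refine tendsto_tsum_of_dominated_convergence hs (fun s => ?_)
    (Filter.Eventually.of_forall fun j s => ?_)
  · exact tendsto_const_nhds.congr'
      ((eventually_liftWeight_eq_zero hconn hΓ s).mono fun j hj => hj.symm)
  · rw [Real.norm_of_nonneg (liftWeight_nonneg _ hr s)]
    exact liftWeight_le _ hr s

end ClosedPaths

/-! ### Counting closed geodesics in a covering -/

section Counting

variable {Q : Type*} [Quiver Q] {x₀ : Q} (H : Subgroup (FundGroup x₀))

/-- The fibre of the covering `H \ X → Q` over a vertex. -/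
abbrev CoverFibre (a : Quiver.Symmetrify Q) : Type _ := Quotient (coverSetoid (Q := Q) H a)

/-- A closed geodesic of `H \ X`, with its starting point, as a closed path of `Q` with a point
of the fibre over its base point. -/
def basedGeodesicToFibre (c : BasedPrimitiveGeodesic (Cover H)) :
    Σ s : ClosedPath Q, CoverFibre H s.1 :=
  ⟨⟨_, (coverMap H).symmetrify.mapPath c.path⟩, Cover.cls c.base⟩

/-- A path in a covering is determined by its starting point and its projection. -/
theorem basedGeodesicToFibre_injective : Function.Injective (basedGeodesicToFibre H) := by
  rintro ⟨⟨a, y⟩, p, _, _⟩ ⟨⟨b, z⟩, q, _, _⟩ h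
  have hbase : Cover.mk a y = Cover.mk b z :=
    congrArg (fun t : Σ s : ClosedPath Q, CoverFibre H s.1 => Cover.mk (Q := Q) t.1.1 t.2) h
  cases hbase
  have hpath := eq_of_heq (Sigma.mk.inj (congrArg Sigma.fst h)).2
  cases (coverMap H).symmetrify.pathStar_injective
    (fun u => ((coverMap_isCovering H).symmetrify.star_bijective u).1) _
    (a₁ := ⟨_, p⟩) (a₂ := ⟨_, q⟩) (congrArg (Sigma.mk _) hpath)
  rfl

/-- The projection of a closed geodesic is reduced, hence not homotopic to a point, and it has a
closed lift; so its weight is not zero. -/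
theorem liftWeight_basedGeodesicToFibre (r : ℝ) (c : BasedPrimitiveGeodesic (Cover H)) :
    liftWeight H r (basedGeodesicToFibre H c).1 = r ^ c.path.length := by
  have hred : FreeGroup.IsReduced (word ((coverMap H).symmetrify.mapPath c.path)) :=
    (c.isClosedGeodesic.2.of_comp_left).isReduced_word_mapPath (coverMap_isCovering H)
  have hlen : ((coverMap H).symmetrify.mapPath c.path).length = c.path.length :=
    length_mapPath _ _
  refine (if_pos ⟨pathClass_ne_id (hlen ▸ c.isClosedGeodesic.1) hred,
    exists_conj_pathClass_mem H c.path⟩).trans ?_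
  exact congrArg (r ^ ·) hlen

variable {H}

/-- The length of a closed geodesic, read off from an arbitrarily chosen starting point. -/
noncomputable def PrimitiveGeodesic.length {P : Type*} [Quiver P] (γ : PrimitiveGeodesic P) : ℕ :=
  (Quot.out γ).path.length

theorem PrimitiveGeodesic.length_pos {P : Type*} [Quiver P] (γ : PrimitiveGeodesic P) :
    0 < γ.length :=
  (Quot.out γ).isClosedGeodesic.1

/-- Normalized by the degree `[Γ : H]` of the covering, the sum of `r ^ l(γ)` over the primitive
closed geodesics of `H \ X` is at most the total weight of the closed paths downstairs, because
every closed path has at most `[Γ : H]` lifts. -/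
theorem summable_pow_length_and_tsum_le [H.FiniteIndex]
    (hconn : ∀ a b : Quiver.Symmetrify Q, Nonempty (Quiver.Path a b)) {r : ℝ} (hr : 0 ≤ r)
    (hs : Summable fun s : ClosedPath Q => r ^ s.2.length) :
    (Summable fun γ : PrimitiveGeodesic (Cover H) => r ^ γ.length) ∧
      ∑' γ : PrimitiveGeodesic (Cover H), r ^ γ.length ≤
        H.index * ∑' s, liftWeight H r s := by
  have hcard : ∀ s : ClosedPath Q,
      Nat.card (CoverFibre H s.1) = H.index := fun s => by
    obtain ⟨q⟩ := hconn x₀ s.1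
    exact card_fibre_cover H (pathClass q)
  have hfin : ∀ s : ClosedPath Q, Finite (CoverFibre H s.1) := fun s =>
    Nat.finite_of_card_ne_zero (by rw [hcard]; exact Subgroup.FiniteIndex.index_ne_zero)
  let f : (Σ s : ClosedPath Q, CoverFibre H s.1) → ℝ :=
    fun t => liftWeight H r t.1
  have hf0 : ∀ t, 0 ≤ f t := fun t => liftWeight_nonneg H hr _
  have hfib : ∀ s : ClosedPath Q, ∑' y : CoverFibre H s.1, f ⟨s, y⟩ =
      H.index * liftWeight H r s := fun s => by
    refine (tsum_const (liftWeight H r s)).trans ?_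
    rw [hcard, nsmul_eq_mul]
  have hf : Summable f := by
    refine (summable_sigma_of_nonneg hf0).2 ⟨fun s => ?_, ?_⟩
    · have := hfin s
      have := Fintype.ofFinite (CoverFibre H s.1)
      exact (hasSum_fintype _).summable
    · simp only [hfib]
      exact (summable_liftWeight H hr hs).mul_left _
  let T : PrimitiveGeodesic (Cover H) → Σ s : ClosedPath Q, CoverFibre H s.1 :=
    fun γ => basedGeodesicToFibre H (Quot.out γ)
  have hT : Function.Injective T := (basedGeodesicToFibre_injective H).comp
    (Function.LeftInverse.injective Quot.out_eq)
  have hfT : ∀ γ, f (T γ) = r ^ γ.length := fun γ => liftWeight_basedGeodesicToFibre H r _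
  have hsum : Summable fun γ : PrimitiveGeodesic (Cover H) => r ^ γ.length :=
    (hf.comp_injective hT).congr hfT
  refine ⟨hsum, ?_⟩
  calc ∑' γ : PrimitiveGeodesic (Cover H), r ^ γ.length
      ≤ ∑' t, f t := hsum.tsum_le_tsum_of_inj T hT (fun t _ => hf0 t) (fun γ => (hfT γ).ge) hf
    _ = ∑' s, H.index * liftWeight H r s := by
        rw [hf.tsum_sigma]
        exact tsum_congr hfib
    _ = _ := tsum_mul_left

end Counting

/-! ### Continuous roots of infinite products -/

section Roots

/-- The unique continuous branch of `Z ^ (1 / N)` with value `1` at `0`: the quotient of two such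
branches takes values in the finite set of `N`-th roots of unity. -/
theorem IsRootOnDisc.eqOn {N : ℕ} (hN : N ≠ 0) {r : ℝ} {Z f g : ℂ → ℂ}
    (hf : IsRootOnDisc N r Z f) (hg : IsRootOnDisc N r Z g)
    (hZ : ∀ u ∈ Metric.ball (0 : ℂ) r, Z u ≠ 0) : Set.EqOn f g (Metric.ball 0 r) := by
  intro u hu
  have hg0 : ∀ v ∈ Metric.ball (0 : ℂ) r, g v ≠ 0 := fun v hv h =>
    hZ v hv (by rw [← hg.pow_eq v hv, h, zero_pow hN])
  have hfin : {z : ℂ | z ^ N = 1}.Finite := by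
    refine (Polynomial.nthRoots N (1 : ℂ)).toFinset.finite_toSet.subset fun z hz => ?_
    simpa [Polynomial.mem_nthRoots hN.bot_lt] using hz
  have hmaps : Set.MapsTo (fun v => f v / g v) (Metric.ball 0 r) {z : ℂ | z ^ N = 1} := by
    intro v hv
    rw [Set.mem_ofPred_eq, div_pow, hf.pow_eq v hv, hg.pow_eq v hv, div_self (hZ v hv)]
  have h := (convex_ball (0 : ℂ) r).isPreconnected.constant_of_mapsTo hfin.isDiscrete
    (hf.continuousOn.div hg.continuousOn hg0) hmaps hu
    (Metric.mem_ball_self (Metric.pos_of_mem_ball hu))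
  rw [Pi.div_apply, Pi.div_apply, hf.map_zero, hg.map_zero, div_one] at h
  exact (div_eq_one_iff_eq (hg0 u hu)).1 h

variable {ι : Type*} {r : ℝ} {φ : ι → ℂ → ℂ} {b : ι → ℝ}

theorem norm_log_le_of_norm_sub_one_le {z : ℂ} {b : ℝ} (h : ‖z - 1‖ ≤ b) (hb : b ≤ 1 / 2) :
    ‖Complex.log z‖ ≤ 3 / 2 * b := by
  have := Complex.norm_log_one_add_half_le_self (h.trans hb)
  rw [add_sub_cancel] at this
  linarith

theorem exp_tsum_log_eq_tprod (hb : Summable b) (hb2 : ∀ i, b i ≤ 1 / 2) {u : ℂ}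
    (h : ∀ i, ‖φ i u - 1‖ ≤ b i) :
    Complex.exp (∑' i, Complex.log (φ i u)) = ∏' i, φ i u := by
  refine Complex.cexp_tsum_eq_tprod (f := fun i => φ i u) (fun i h0 => ?_)
    ((hb.mul_left (3 / 2)).of_norm_bounded fun i => norm_log_le_of_norm_sub_one_le (h i) (hb2 i))
  have := (h i).trans (hb2 i)
  rw [h0] at this
  norm_num at this

/-- Since the factors stay within `1 / 2` of `1`, the principal branch of the logarithm is
continuous on all of them, and the series of logarithms converges uniformly. -/
theorem isRootOnDisc_exp_tsum_log (hb : Summable b) (hb2 : ∀ i, b i ≤ 1 / 2)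
    (hφ : ∀ i, Continuous (φ i)) (hφ0 : ∀ i, φ i 0 = 1)
    (h : ∀ u ∈ Metric.ball (0 : ℂ) r, ∀ i, ‖φ i u - 1‖ ≤ b i) {N : ℕ} (hN : N ≠ 0) :
    IsRootOnDisc N r (fun u => ∏' i, φ i u)
      fun u => Complex.exp ((N : ℂ)⁻¹ * ∑' i, Complex.log (φ i u)) where
  continuousOn := by
    refine Complex.continuous_exp.comp_continuousOn (continuousOn_const.mul ?_)
    refine continuousOn_tsum (fun i u hu => ?_) (hb.mul_left (3 / 2))
      fun i u hu => norm_log_le_of_norm_sub_one_le (h u hu i) (hb2 i)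
    refine ((hφ i).continuousAt.clog ?_).continuousWithinAt
    have h₁ := ((h u hu i).trans (hb2 i)).trans_lt one_half_lt_one
    have := Complex.mem_slitPlane_of_norm_lt_one h₁
    rwa [add_sub_cancel] at this
  map_zero := by simp [hφ0]
  pow_eq u hu := by
    rw [← Complex.exp_nat_mul, mul_inv_cancel_left₀ (Nat.cast_ne_zero.2 hN),
      exp_tsum_log_eq_tprod hb hb2 (h u hu)]

end Roots

/-! ### The logarithm of the zeta function -/

section EulerFactors

variable {P : Type*} [Quiver P] (F : HermitianLocalSystem P)

theorem eulerFactor_eq_pathFactor_out (γ : PrimitiveGeodesic P) :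
    F.eulerFactor γ = F.pathFactor (Quot.out γ).path := by
  conv_lhs => rw [← Quot.out_eq γ]
  rfl

theorem norm_eulerFactor_sub_one_le {r C : ℝ} (hr : r ≤ 1)
    (hC : ∀ a : P, ((Module.finrank ℂ (F.stalk a)).factorial : ℝ) *
      2 ^ Module.finrank ℂ (F.stalk a) ≤ C)
    {u : ℂ} (hu : u ∈ Metric.ball (0 : ℂ) r) (γ : PrimitiveGeodesic P) :
    ‖F.eulerFactor γ u - 1‖ ≤ C * r ^ γ.length := by
  rw [mem_ball_zero_iff] at hu
  rw [eulerFactor_eq_pathFactor_out]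
  refine (norm_pathFactor_sub_one_le F _ (hu.le.trans hr)).trans ?_
  have h0 := hC (HermitianLocalSystem.toVertex (Quot.out γ).base)
  exact mul_le_mul h0 (pow_le_pow_left₀ (norm_nonneg _) hu.le _) (by positivity)
    (le_trans (by positivity) h0)

/-- The branch of `Z ^ (1 / N)` on a disc on which every Euler factor is within `1 / 2` of `1`,
with the resulting bound for the logarithm `L` of `Z`. -/
theorem exists_log_zeta {r C : ℝ} (hr0 : 0 ≤ r) (hr : r ≤ 1) (hC0 : 0 ≤ C) (hCr : C * r ≤ 1 / 2)
    (hC : ∀ a : P, ((Module.finrank ℂ (F.stalk a)).factorial : ℝ) *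
      2 ^ Module.finrank ℂ (F.stalk a) ≤ C)
    (hs : Summable fun γ : PrimitiveGeodesic P => r ^ γ.length) {N : ℕ} (hN : N ≠ 0) :
    ∃ L : ℂ → ℂ, IsRootOnDisc N r F.zeta (fun u => Complex.exp ((N : ℂ)⁻¹ * L u)) ∧
      ∀ u ∈ Metric.ball (0 : ℂ) r, Complex.exp (L u) = F.zeta u ∧
        ‖L u‖ ≤ 3 / 2 * (C * ∑' γ : PrimitiveGeodesic P, r ^ γ.length) := by
  have hb : Summable fun γ : PrimitiveGeodesic P => C * r ^ γ.length := hs.mul_left C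
  have hb2 : ∀ γ : PrimitiveGeodesic P, C * r ^ γ.length ≤ 1 / 2 := fun γ =>
    (mul_le_mul_of_nonneg_left (pow_le_of_le_one hr0 hr γ.length_pos.ne') hC0).trans hCr
  have hF : ∀ u ∈ Metric.ball (0 : ℂ) r, ∀ γ, ‖F.eulerFactor γ u - 1‖ ≤ C * r ^ γ.length :=
    fun u hu => norm_eulerFactor_sub_one_le F hr hC hu
  refine ⟨fun u => ∑' γ, Complex.log (F.eulerFactor γ u), ?_, fun u hu => ⟨?_, ?_⟩⟩
  · refine isRootOnDisc_exp_tsum_log hb hb2 (fun γ => ?_) (fun γ => ?_) hF hN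
    · rw [eulerFactor_eq_pathFactor_out]
      exact continuous_pathFactor _ _
    · rw [eulerFactor_eq_pathFactor_out]
      exact pathFactor_zero _ γ.length_pos
  · exact exp_tsum_log_eq_tprod hb hb2 (hF u hu)
  · exact tsum_of_norm_bounded ((hs.hasSum.mul_left C).mul_left (3 / 2))
      fun γ => norm_log_le_of_norm_sub_one_le (hF u hu γ) (hb2 γ)

/-- One constant serves all Euler factors, also on every covering, as the stalks there are the
same. -/
theorem exists_finrank_bound [Finite P] : ∃ C : ℝ, 0 ≤ C ∧
    ∀ a : P, ((Module.finrank ℂ (F.stalk a)).factorial : ℝ) *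
      2 ^ Module.finrank ℂ (F.stalk a) ≤ C := by
  have := Fintype.ofFinite P
  refine ⟨∑ a, ((Module.finrank ℂ (F.stalk a)).factorial : ℝ) *
    2 ^ Module.finrank ℂ (F.stalk a), Finset.sum_nonneg fun _ _ => by positivity, fun a => ?_⟩
  exact Finset.single_le_sum (f := fun a => ((Module.finrank ℂ (F.stalk a)).factorial : ℝ) *
    2 ^ Module.finrank ℂ (F.stalk a)) (fun _ _ => by positivity) (Finset.mem_univ a)

/-- With `C` bounding the Euler factors and `D` the number of oriented edges, the first product
bound keeps the logarithms small and the second makes the sum over closed paths converge. -/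
theorem exists_radius {C D : ℝ} (hC : 0 ≤ C) (hD : 0 ≤ D) :
    ∃ r : ℝ, 0 < r ∧ r ≤ 1 ∧ C * r ≤ 1 / 2 ∧ D * r < 1 := by
  have hr0 : 0 < (2 * (C + D + 1))⁻¹ := by positivity
  have hr2 : 2 * (C + D + 1) * (2 * (C + D + 1))⁻¹ = 1 := mul_inv_cancel₀ (by positivity)
  generalize (2 * (C + D + 1))⁻¹ = r at hr0 hr2
  exact ⟨r, hr0, by nlinarith, by nlinarith, by nlinarith⟩

end EulerFactors

end GraphZeta

open GraphZeta

theorem mainTheorem3 {Q : Type*} [Quiver Q] [Finite Q] [∀ a b : Q, Finite (a ⟶ b)]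
    (hconn : ∀ a b : Quiver.Symmetrify Q, Nonempty (Quiver.Path a b))
    (F : GraphZeta.HermitianLocalSystem Q) (x₀ : Q) :
    ∃ r : ℝ, 0 < r ∧
      ∀ Γ : ℕ → Subgroup (GraphZeta.FundGroup x₀), GraphZeta.IsTower Γ →
        (∀ j, ∀ u ∈ Metric.ball (0 : ℂ) r,
          (F.pullback (GraphZeta.coverMap (Γ j))).ZetaConverges u) ∧
        (∀ j, ∃ f : ℂ → ℂ, GraphZeta.IsRootOnDisc (Γ j).index r
          (F.pullback (GraphZeta.coverMap (Γ j))).zeta f) ∧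
        ∀ f : ℕ → ℂ → ℂ,
          (∀ j, GraphZeta.IsRootOnDisc (Γ j).index r
            (F.pullback (GraphZeta.coverMap (Γ j))).zeta (f j)) →
          ∀ u ∈ Metric.ball (0 : ℂ) r,
            Filter.Tendsto (fun j => f j u) Filter.atTop (nhds 1) := by
  obtain ⟨C, hC0, hC⟩ := exists_finrank_bound F
  obtain ⟨r, hr0, hr1, hCr, hDr⟩ := exists_radius hC0
    (Nat.cast_nonneg (α := ℝ) (Nat.card ((Σ a b : Q, a ⟶ b) × Bool)))
  have hs := summable_pow_length_closedPath (Q := Q) hr0.le hDr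
  refine ⟨r, hr0, fun Γ hΓ => ?_⟩
  have hN : ∀ j, (Γ j).index ≠ 0 := fun j => (hΓ.finiteIndex j).index_ne_zero
  have hsum : ∀ j, (Summable fun γ : PrimitiveGeodesic (Cover (Γ j)) => r ^ γ.length) ∧
      ∑' γ : PrimitiveGeodesic (Cover (Γ j)), r ^ γ.length ≤
        (Γ j).index * ∑' s, liftWeight (Γ j) r s := fun j =>
    have := hΓ.finiteIndex j
    summable_pow_length_and_tsum_le hconn hr0.le hs
  have hCΓ : ∀ j, ∀ A : Cover (Γ j),
      ((Module.finrank ℂ ((F.pullback (coverMap (Γ j))).stalk A)).factorial : ℝ) *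
        2 ^ Module.finrank ℂ ((F.pullback (coverMap (Γ j))).stalk A) ≤ C := fun j A => hC A.pt
  choose L hroot hL using fun j =>
    exists_log_zeta (F.pullback (coverMap (Γ j))) hr0.le hr1 hC0 hCr (hCΓ j) (hsum j).1 (hN j)
  refine ⟨fun j u hu => ((hsum j).1.mul_left C).of_nonneg_of_le (fun _ => norm_nonneg _)
    (norm_eulerFactor_sub_one_le _ hr1 (hCΓ j) hu), fun j => ⟨_, hroot j⟩, fun f hf u hu => ?_⟩
  have hfu : ∀ j, f j u = Complex.exp (((Γ j).index : ℂ)⁻¹ * L j u) := fun j =>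
    (hf j).eqOn (hN j) (hroot j) (fun v hv => (hL j v hv).1 ▸ Complex.exp_ne_zero _) hu
  -- The index cancels: it bounds the number of lifts of each closed path of the base graph.
  have hlim : Filter.Tendsto (fun j => ((Γ j).index : ℂ)⁻¹ * L j u) Filter.atTop (nhds 0) := by
    refine squeeze_zero_norm (a := fun j => 3 / 2 * C * ∑' s, liftWeight (Γ j) r s) (fun j => ?_)
      (by simpa using (tendsto_tsum_liftWeight hconn hΓ hr0.le hs).const_mul (3 / 2 * C))
    have hN' : (0 : ℝ) < (Γ j).index := Nat.cast_pos.2 (hN j).bot_lt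
    rw [norm_mul, norm_inv, Complex.norm_natCast, inv_mul_le_iff₀ hN']
    calc ‖L j u‖ ≤ 3 / 2 * (C * ∑' γ : PrimitiveGeodesic (Cover (Γ j)), r ^ γ.length) :=
          (hL j u hu).2
      _ ≤ 3 / 2 * (C * ((Γ j).index * ∑' s, liftWeight (Γ j) r s)) :=
          mul_le_mul_of_nonneg_left (mul_le_mul_of_nonneg_left (hsum j).2 hC0) (by norm_num)
      _ = (Γ j).index * (3 / 2 * C * ∑' s, liftWeight (Γ j) r s) := by ring
  simp only [hfu]
  have h := (Complex.continuous_exp.tendsto 0).comp hlim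
  rwa [Complex.exp_zero] at h
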